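/- Let $\varrho \ge 1$ be an integer and let $d = (d(k))_{k \ge 0}$ be a sequence of non-negative integers with finite support such that $\varrho = \sum_{k \ge 0} (1-k)\, d(k)$. Let $\mathbf{T}_d^{\varrho}$ denote the (finite, non-empty) set of plane forests, i.e. finite ordered lists of plane trees, which have $\varrho$ trees and, for every $k \ge 0$, exactly $d(k)$ vertices with $k$ children. Set \[\Delta = \max\{k \ge 0 : d(k) > 0\}, \qquad \epsilon = \sum_{k \ge 1} k\, d(k), \qquad \sigma = \Big(\sum_{k \ge 1} k(k-1)\, d(k)\Big)^{1/2}.\] Let $T$ be a uniformly random element of $\mathbf{T}_d^{\varrho}$ and, given $T$, let $x$ be a uniformly random vertex of $T$; let $|x|$ denote its height, i.e. its graph distance to the root of the tree of $T$ which contains it. **Proposition.** There exist two universal constants $c_1, c_2 > 0$ such that, for every $\varrho$ and $d$ as above with $\Delta \ge 2$ and every real number $z \ge 1$, \[\mathbb{P}\left(|x| \ge z\, \frac{\epsilon}{\sigma}\right) \le c_1\, \mathrm{e}^{-c_2 z}.\] In particular, for any sequence $(\varrho_n, d_n)_{n \ge 1}$ of such data with $\Delta_n \ge 2$, the bound holds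 uniformly in $n$ and $z \ge 1$, with constants that do not depend on the sequence. -/

import Mathlib

/-- A (finite) plane tree: a root vertex together with the ordered list of the subtrees
that hang from its children. -/
inductive PlaneTree : Type
  | node (children : List PlaneTree) : PlaneTree

/-- A plane forest: a finite ordered list of plane trees. -/
abbrev PlaneForest : Type := List PlaneTree

namespace PlaneForest

/-- The vertices of a forest in lexicographic (depth-first) order. Each vertex is recorded as the
pair (height, number of children), the roots of the trees of the forest having height `h`. -/
def visit : ℕ → PlaneForest → List (ℕ × ℕ)
  | _, [] => []
  | h, PlaneTree.node cs :: ts => (h, cs.length) :: (visit (h + 1) cs ++ visit h ts)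

/-- The vertices of a forest, identified with their index in lexicographic order. -/
abbrev Vertex (F : PlaneForest) : Type := Fin (visit 0 F).length

/-- The height `|x|` of a vertex, i.e. its graph distance to the root of the tree that
contains it (in particular the roots of the trees have height `0`). -/
def height {F : PlaneForest} (x : Vertex F) : ℕ := ((visit 0 F).get x).1

/-- The number of children of a vertex. -/
def numChildren {F : PlaneForest} (x : Vertex F) : ℕ := ((visit 0 F).get x).2

theorem visit_append (h : ℕ) (F G : PlaneForest) :
    visit h (F ++ G) = visit h F ++ visit h G := by
  induction F with
  | nil => simp [visit]
  | cons t ts ih => cases t; simp [visit, ih]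

/-- The multiset of out-degrees does not depend on the height given to the roots. -/
theorem visit_map_snd (h h' : ℕ) (F : PlaneForest) :
    (visit h F).map Prod.snd = (visit h' F).map Prod.snd := by
  induction h, F using visit.induct generalizing h' with
  | case1 h => simp [visit]
  | case2 h cs ts ih1 ih2 => simp [visit, ih1 (h' + 1), ih2 h']

theorem finite_length_le (m : ℕ) : {F : PlaneForest | (visit 0 F).length ≤ m}.Finite := by
  have hlen : ∀ (h h' : ℕ) (F : PlaneForest), (visit h F).length = (visit h' F).length := by
    intro h h' F
    simpa using congrArg List.length (visit_map_snd h h' F)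
  induction m with
  | zero =>
    refine (Set.finite_singleton ([] : PlaneForest)).subset ?_
    rintro (_ | ⟨⟨cs⟩, ts⟩) hF
    · simp
    · simp [visit] at hF
  | succ m ih =>
    refine ((Set.Finite.image2 (fun cs ts => PlaneTree.node cs :: ts) ih ih).insert []).subset ?_
    rintro (_ | ⟨⟨cs⟩, ts⟩) hF
    · simp
    · refine Set.mem_insert_of_mem _ ⟨cs, ?_, ts, ?_, rfl⟩
      · simp only [Set.mem_ofPred_eq, visit, List.length_cons, List.length_append] at hF ⊢
        rw [hlen (0 + 1) 0] at hF; omega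
      · simp only [Set.mem_ofPred_eq, visit, List.length_cons, List.length_append] at hF ⊢
        omega

/-- Joining the first trees of a forest under new vertices with out-degrees in `l`. -/
theorem exists_join (r : ℕ) (hr : 1 ≤ r) (l : List ℕ) (hl : ∀ k ∈ l, 1 ≤ k) (F : PlaneForest)
    (hF : F.length + l.length = r + l.sum) :
    ∃ G : PlaneForest, G.length = r ∧
      ((visit 0 G).map Prod.snd).Perm (l ++ (visit 0 F).map Prod.snd) := by
  induction l generalizing F with
  | nil => exact ⟨F, by simpa using hF, by simp⟩
  | cons k l ih =>
    have hk : 1 ≤ k := hl k (by simp)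
    have hsum : l.length ≤ l.sum := by
      have := List.card_nsmul_le_sum l 1 (fun x hx => hl x (by simp [hx]))
      simpa using this
    simp only [List.length_cons, List.sum_cons] at hF
    have hkF : k ≤ F.length := by omega
    obtain ⟨G, hG, hp⟩ := ih (fun x hx => hl x (by simp [hx]))
      (PlaneTree.node (F.take k) :: F.drop k) (by simp; omega)
    refine ⟨G, hG, hp.trans ?_⟩
    have h1 : (visit 0 F).map Prod.snd
        = (visit 1 (F.take k)).map Prod.snd ++ (visit 0 (F.drop k)).map Prod.snd := by
      rw [visit_map_snd 1 0, ← List.map_append, ← visit_append, List.take_append_drop]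
    rw [h1]
    simp only [visit, List.map_cons, List.map_append, List.length_take, min_eq_left hkF, zero_add,
      List.cons_append]
    exact List.perm_middle

end PlaneForest

/-- A degree sequence: for every `k ≥ 0` the number `count k` of vertices with `k` children
(all but finitely many being zero), and the number `trees ≥ 1` of trees, related by
`trees = ∑_{k ≥ 0} (1 - k) * count k`. -/
structure DegreeSequence where
  count : ℕ →₀ ℕ
  trees : ℕ
  trees_pos : 1 ≤ trees
  trees_eq : (trees : ℤ) = ∑ k ∈ count.support, (1 - (k : ℤ)) * (count k : ℤ)

namespace DegreeSequence

/-- The largest out-degree, `Δ = max {k ≥ 0 : count k > 0}`. -/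
def maxDegree (D : DegreeSequence) : ℕ := D.count.support.sup id

/-- The number of edges, `ε = ∑_{k ≥ 1} k * count k`. -/
def numEdges (D : DegreeSequence) : ℕ := ∑ k ∈ D.count.support, k * D.count k

/-- The square root `σ` of the global variance term `σ ^ 2 = ∑_{k ≥ 1} k * (k - 1) * count k`. -/
noncomputable def sigma (D : DegreeSequence) : ℝ :=
  Real.sqrt (∑ k ∈ D.count.support, (k : ℝ) * ((k : ℝ) - 1) * (D.count k : ℝ))

/-- The plane forests with `trees` trees and, for every `k ≥ 0`, exactly `count k` vertices
with `k` children. -/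
def Forest (D : DegreeSequence) : Type :=
  {F : PlaneForest // F.length = D.trees ∧
    ∀ k : ℕ, (Finset.univ.filter fun x : PlaneForest.Vertex F =>
      PlaneForest.numChildren x = k).card = D.count k}

theorem card_numChildren (F : PlaneForest) (k : ℕ) :
    (Finset.univ.filter fun x : PlaneForest.Vertex F => PlaneForest.numChildren x = k).card
      = ((PlaneForest.visit 0 F).map Prod.snd).count k := by
  have h := Fin.card_filter_univ_eq_vector_get_eq_count k
    (⟨(PlaneForest.visit 0 F).map Prod.snd, by simp⟩ :
      List.Vector ℕ (PlaneForest.visit 0 F).length)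
  rw [List.Vector.toList_mk] at h
  rw [← h]
  congr 1
  ext x
  simp [PlaneForest.numChildren, List.Vector.get, eq_comm]

theorem length_visit (D : DegreeSequence) (F : PlaneForest)
    (hF : ∀ k : ℕ, (Finset.univ.filter fun x : PlaneForest.Vertex F =>
      PlaneForest.numChildren x = k).card = D.count k) :
    (PlaneForest.visit 0 F).length = ∑ k ∈ D.count.support, D.count k := by
  have h := Finset.card_eq_sum_card_fiberwise
    (f := fun x : PlaneForest.Vertex F => PlaneForest.numChildren x)
    (s := Finset.univ) (t := D.count.support) (by
      intro x _
      have : 0 < D.count (PlaneForest.numChildren x) := by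
        rw [← hF]
        exact Finset.card_pos.2 ⟨x, by simp⟩
      simpa using this.ne')
  rw [Finset.card_univ, Fintype.card_fin] at h
  rw [h]
  exact Finset.sum_congr rfl fun k _ => hF k

instance (D : DegreeSequence) : Finite D.Forest := by
  refine ((PlaneForest.finite_length_le (∑ k ∈ D.count.support, D.count k)).subset ?_).to_subtype
  rintro F ⟨_, hF⟩
  exact (length_visit D F hF).le

instance (D : DegreeSequence) : Nonempty D.Forest := by
  classical
  set m : Multiset ℕ := Finsupp.toMultiset D.count with hm
  set l : List ℕ := (m.filter (1 ≤ ·)).toList with hl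
  have hcount : ∀ k, m.count k = D.count k := fun k => Finsupp.count_toMultiset _ _
  obtain ⟨G, hG, hp⟩ := PlaneForest.exists_join D.trees D.trees_pos l
    (by intro k hk; simpa [hl] using (Multiset.mem_filter.1 (Multiset.mem_toList.1 hk)).2)
    (List.replicate (D.count 0) (PlaneTree.node [])) (by
      have h0 : m = m.filter (1 ≤ ·) + Multiset.replicate (D.count 0) 0 := by
        ext k
        rcases Nat.eq_zero_or_pos k with rfl | hk
        · simp [hcount]
        · simp [hcount, Multiset.count_replicate, hk.ne,
            Nat.one_le_iff_ne_zero.2 hk.ne']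
      have hc : m.card = l.length + D.count 0 := by
        conv_lhs => rw [h0]
        simp [hl]
      have hs : m.sum = l.sum := by
        conv_lhs => rw [h0]
        simp [hl]
      have hc' : m.card = ∑ k ∈ D.count.support, D.count k := by
        rw [hm, Finsupp.card_toMultiset]; rfl
      have hs' : m.sum = ∑ k ∈ D.count.support, D.count k * k := by
        rw [hm, Finsupp.sum_toMultiset]; rfl
      have ht := D.trees_eq
      simp only [sub_mul, one_mul, Finset.sum_sub_distrib] at ht
      rw [List.length_replicate]
      zify at hc hs hc' hs' ⊢
      simp only [mul_comm] at hs' ht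
      linarith)
  refine ⟨⟨G, hG, fun k => ?_⟩⟩
  have hrep : ∀ n : ℕ, (PlaneForest.visit 0 (List.replicate n (PlaneTree.node []))).map Prod.snd
      = List.replicate n 0 := by
    intro n
    induction n with
    | zero => simp [PlaneForest.visit]
    | succ n ih => simpa [List.replicate_succ, PlaneForest.visit] using ih
  have hlc : l.count k = (m.filter (1 ≤ ·)).count k := by
    rw [hl, ← Multiset.coe_count, Multiset.coe_toList]
  rw [card_numChildren, hp.count_eq, List.count_append, hlc, hrep, Multiset.count_filter, hcount,
    List.count_replicate]
  rcases Nat.eq_zero_or_pos k with rfl | hk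
  · simp
  · simp [hk.ne, Nat.one_le_iff_ne_zero.2 hk.ne']

instance (D : DegreeSequence) (F : D.Forest) : Nonempty (PlaneForest.Vertex F.1) := by
  rcases F with ⟨F, hF, _⟩
  have := D.trees_pos
  rcases F with _ | ⟨⟨cs⟩, ts⟩
  · simp at hF; omega
  · exact ⟨⟨0, by simp [PlaneForest.visit]⟩⟩

noncomputable instance (D : DegreeSequence) : Fintype D.Forest := Fintype.ofFinite _

/-- The law of the uniformly random forest with the given degree sequence. -/
noncomputable def uniformForest (D : DegreeSequence) : PMF D.Forest :=
  PMF.uniformOfFintype D.Forest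

/-- The joint law of the uniformly random forest and of a vertex which, given the forest, is
uniformly random among its vertices. -/
noncomputable def uniformVertex (D : DegreeSequence) :
    PMF ((F : D.Forest) × PlaneForest.Vertex F.1) :=
  D.uniformForest.bind fun F => (PMF.uniformOfFintype (PlaneForest.Vertex F.1)).map (Sigma.mk F)

end DegreeSequence

/-!
The proof rests on an exact formula. Let `n` be the number of vertices and `e h` the `h`-th
elementary symmetric polynomial of the `n` prescribed out-degrees. Then
`ℙ (|x| ≥ h) = e h / n.choose h`, the mean product of the out-degrees of `h` vertices drawn without
replacement.

For the formula, the trees of a uniformly random forest are exchangeable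
(`PlaneForest.sum_countAbove_getElem`), so that `x` may be required to lie in the first tree.
Removing the root of that tree, of out-degree `k`, and using exchangeability again for its `k`
subtrees turns the count for `h + 1` into a sum over `k` of `k` times the count for `h` without one
vertex of out-degree `k`. The same removal of a root gives the number of forests
(`PlaneForest.countFactorial_mul_card_forests`), hence the count for `h = 0`; together they give
`PlaneForest.countFactorial_mul_countFirst`.

For the tail, write `ε` for the sum of the out-degrees and `s \ k` for the out-degrees without `k`.
Expanding `e (h + 1)` along one element gives
`(h + 1) * e (h + 1) = (ε - h) * e h - ∑ k * (k - 1) * e (h - 1) (s \ k)`, and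
`e (h - 1) (s \ k) ≥ h * e h / (h * k + ε)`. As every out-degree is at most `2 * σ`, the sum is at
least `σ / 4 * e h` as soon as `h ≥ ε / (2 * σ)` (`Multiset.succ_mul_esymm_succ_le`). Since `n ≥ ε`,
the ratio of successive tail probabilities is then at most `1 - σ / (4 * ε)`
(`Multiset.factorial_mul_esymm_succ_le`). This holds from `h = ⌊ε / σ⌋` on because `σ ≤ ε`, and
iterating it up to `z * ε / σ` gives the exponential bound.
-/

/-! ### Elementary symmetric polynomials of a multiset -/

namespace Multiset

theorem esymm_zero' {R : Type*} [CommSemiring R] (s : Multiset R) : s.esymm 0 = 1 := by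
  simp [esymm]

theorem esymm_cons_succ {R : Type*} [CommSemiring R] (a : R) (s : Multiset R) (h : ℕ) :
    (a ::ₘ s).esymm (h + 1) = s.esymm (h + 1) + a * s.esymm h := by
  simp only [esymm, powersetCard_cons, map_add, sum_add, map_map, Function.comp_def, prod_cons,
    sum_map_mul_left]

theorem esymm_eq_add_mul_esymm_erase {R : Type*} [CommSemiring R] [DecidableEq R] {a : R}
    {s : Multiset R} (ha : a ∈ s) (h : ℕ) :
    s.esymm (h + 1) = (s.erase a).esymm (h + 1) + a * (s.erase a).esymm h := by
  conv_lhs => rw [← cons_erase ha]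
  exact esymm_cons_succ _ _ _

theorem esymm_eq_zero_of_card_lt {R : Type*} [CommSemiring R] {s : Multiset R} {h : ℕ}
    (hs : card s < h) : s.esymm h = 0 := by
  simp [esymm, powersetCard_eq_empty h hs]

/-- Choosing one element of `s`, and then `h` of the others, selects every `(h + 1)`-subset
`h + 1` times. -/
theorem sum_mul_esymm_erase {R : Type*} [CommSemiring R] [DecidableEq R] (s : Multiset R) (h : ℕ) :
    (s.map fun a => a * (s.erase a).esymm h).sum = (h + 1) * s.esymm (h + 1) := by
  induction s using Multiset.induction_on generalizing h with
  | empty =>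
    rw [esymm_eq_zero_of_card_lt (by simp)]
    simp
  | cons a s ih =>
    have key : ∀ h, (s.map fun b => b * ((a ::ₘ s).erase b).esymm h).sum
        = (s.map fun b => b * (a ::ₘ s.erase b).esymm h).sum := fun h =>
      congrArg sum (map_congr rfl fun b hb => by rw [erase_cons_tail_of_mem hb])
    rw [map_cons, sum_cons, erase_cons_head, key]
    cases h with
    | zero => simp [esymm, powersetCard_one, add_comm]
    | succ h =>
      simp only [esymm_cons_succ, mul_add, sum_map_add, ih]
      have : (s.map fun b => b * (a * (s.erase b).esymm h)).sum
          = a * ((h + 1) * s.esymm (h + 1)) := by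
        rw [← ih h, ← sum_map_mul_left]
        exact congrArg sum (map_congr rfl fun b _ => by ring)
      rw [this]
      push_cast
      ring

end Multiset

/-! ### Decay of the normalised elementary symmetric polynomials -/

namespace Multiset

theorem natCast_mul_sub_one_nonneg (k : ℕ) : 0 ≤ (k : ℝ) * ((k : ℝ) - 1) := by
  rcases Nat.eq_zero_or_pos k with rfl | hk
  · simp
  · have : (1 : ℝ) ≤ k := by exact_mod_cast hk
    exact mul_nonneg (by linarith) (by linarith)

theorem sum_map_natCast (s : Multiset ℕ) (f : ℕ → ℕ) :
    ((s.map f).sum : ℝ) = (s.map fun k => (f k : ℝ)).sum := by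
  simp

/-- The lower bound on the weight of the `h`-subsets that contain a given element `k`. -/
theorem mul_esymm_le_mul_esymm_erase {s : Multiset ℕ} {k : ℕ} (hk : k ∈ s) (h : ℕ) :
    (h + 1) * s.esymm (h + 1) ≤ ((h + 1) * k + s.sum) * (s.erase k).esymm h := by
  have h1 : (h + 1) * (s.erase k).esymm (h + 1) ≤ s.sum * (s.erase k).esymm h := by
    have := sum_mul_esymm_erase (s.erase k) h
    rw [Nat.cast_id] at this
    rw [← this]
    have hle : ∀ a ∈ s.erase k, a * ((s.erase k).erase a).esymm h ≤ a * (s.erase k).esymm h := by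
      intro a ha
      refine Nat.mul_le_mul_left _ ?_
      cases h with
      | zero => simp [esymm_zero']
      | succ h =>
        rw [esymm_eq_add_mul_esymm_erase ha]
        exact Nat.le_add_right _ _
    calc ((s.erase k).map fun a => a * ((s.erase k).erase a).esymm h).sum
        ≤ ((s.erase k).map fun a => a * (s.erase k).esymm h).sum := sum_map_le_sum_map _ _ hle
      _ = (s.erase k).sum * (s.erase k).esymm h := by rw [sum_map_mul_right]; simp
      _ ≤ s.sum * (s.erase k).esymm h := by
        refine Nat.mul_le_mul_right _ ?_
        rw [← sum_erase hk]
        exact Nat.le_add_left _ _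
  rw [esymm_eq_add_mul_esymm_erase hk]
  nlinarith

/-- The recursion for the elementary symmetric polynomials `e h`, with the quadratic correction
split into a linear part `h * e h` and a part carried by the elements larger than `1`. -/
theorem succ_mul_esymm_succ_add (s : Multiset ℕ) (h : ℕ) :
    ((h : ℝ) + 2) * (s.esymm (h + 2) : ℝ)
      + (s.map fun k : ℕ => (k : ℝ) * ((k : ℝ) - 1) * ((s.erase k).esymm h : ℝ)).sum
      = ((s.sum : ℝ) - (h + 1)) * (s.esymm (h + 1) : ℝ) := by
  have h1 := congrArg (Nat.cast : ℕ → ℝ) (sum_mul_esymm_erase s (h + 1))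
  have h2 := congrArg (Nat.cast : ℕ → ℝ) (sum_mul_esymm_erase s h)
  rw [sum_map_natCast] at h1 h2
  have h3 : ((s.map fun k : ℕ => ((k * s.esymm (h + 1) : ℕ) : ℝ)).sum)
      = (s.sum : ℝ) * s.esymm (h + 1) := by
    rw [← sum_map_natCast, sum_map_mul_right, map_id', Nat.cast_mul]
  have h4 : (s.map fun k : ℕ => ((k * s.esymm (h + 1) : ℕ) : ℝ)).sum
      = (s.map fun k : ℕ => ((k * (s.erase k).esymm (h + 1) : ℕ) : ℝ)
        + (((k * (s.erase k).esymm h : ℕ) : ℝ)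
          + (k : ℝ) * ((k : ℝ) - 1) * ((s.erase k).esymm h : ℝ))).sum := by
    refine congrArg sum (map_congr rfl fun k hk => ?_)
    rw [esymm_eq_add_mul_esymm_erase hk]
    push_cast
    ring
  rw [sum_map_add, sum_map_add, h1, h2] at h4
  rw [h3] at h4
  simp only [Nat.cast_mul, Nat.cast_add, Nat.cast_one, Nat.cast_id, add_assoc, one_add_one_eq_two,
    Nat.cast_ofNat]    at h4
  linarith

/-- Once `h` is at least of order `ε / σ`, the ratio of the elementary symmetric polynomials
`e (h + 1)` and `e h` gains the term `σ / 4`. Here `ε` is the sum of `s`, and `σ ^ 2` the sum of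
the `k * (k - 1)`. -/
theorem succ_mul_esymm_succ_le {s : Multiset ℕ} {σ : ℝ} (hσ : 0 < σ)
    (hs : (s.map fun k : ℕ => (k : ℝ) * ((k : ℝ) - 1)).sum = σ ^ 2)
    (hmax : ∀ k ∈ s, (k : ℝ) ≤ 2 * σ) {h : ℕ} (hh : (s.sum : ℝ) ≤ 2 * σ * h) (hpos : 1 ≤ h) :
    ((h : ℝ) + 1) * (s.esymm (h + 1) : ℝ)
      ≤ ((s.sum : ℝ) - h - σ / 4) * (s.esymm h : ℝ) := by
  obtain ⟨h, rfl⟩ : ∃ j, h = j + 1 := ⟨h - 1, by omega⟩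
  have hrec := succ_mul_esymm_succ_add s h
  have hlow : (s.map fun k : ℕ => (k : ℝ) * ((k : ℝ) - 1) * ((s.esymm (h + 1) : ℝ) / (4 * σ))).sum
      ≤ (s.map fun k : ℕ => (k : ℝ) * ((k : ℝ) - 1) * ((s.erase k).esymm h : ℝ)).sum := by
    refine sum_map_le_sum_map _ _ fun k hk => ?_
    refine mul_le_mul_of_nonneg_left ?_ (natCast_mul_sub_one_nonneg k)
    have h1 : ((h : ℝ) + 1) * (s.esymm (h + 1) : ℝ)
        ≤ (((h : ℝ) + 1) * k + s.sum) * ((s.erase k).esymm h : ℝ) := by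
      exact_mod_cast mul_esymm_le_mul_esymm_erase hk h
    -- Both `k` and `ε / (h + 1)` are at most `2 * σ`.
    have h2 : ((h : ℝ) + 1) * k + s.sum ≤ ((h : ℝ) + 1) * (4 * σ) := by
      have := mul_le_mul_of_nonneg_left (hmax k hk) (by positivity : (0 : ℝ) ≤ (h : ℝ) + 1)
      rw [Nat.cast_add, Nat.cast_one] at hh
      linarith
    have h3 := mul_le_mul_of_nonneg_right h2 (Nat.cast_nonneg' ((s.erase k).esymm h) (α := ℝ))
    rw [div_le_iff₀ (by positivity)]
    have h4 : ((h : ℝ) + 1) * (s.esymm (h + 1) : ℝ)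
        ≤ ((h : ℝ) + 1) * (((s.erase k).esymm h : ℝ) * (4 * σ)) := by linarith
    exact le_of_mul_le_mul_left h4 (by positivity)
  rw [sum_map_mul_right, hs] at hlow
  have h5 : σ ^ 2 * ((s.esymm (h + 1) : ℝ) / (4 * σ)) = σ / 4 * (s.esymm (h + 1) : ℝ) := by
    field_simp
  rw [h5] at hlow
  rw [Nat.cast_add, Nat.cast_one, add_assoc (h : ℝ), one_add_one_eq_two]
  linarith

end Multiset

open Nat in
/-- The factor `(n - h)! h!` that turns an elementary symmetric polynomial into a weighted count
of the orderings of `s`, absorbs the growth of the number of `h`-subsets. -/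
theorem Multiset.factorial_mul_esymm_succ_le {s : Multiset ℕ} {σ : ℝ} (hσ : 0 < σ)
    (hs : (s.map fun k : ℕ => (k : ℝ) * ((k : ℝ) - 1)).sum = σ ^ 2)
    (hmax : ∀ k ∈ s, (k : ℝ) ≤ 2 * σ) (hle : σ ≤ s.sum) (hcard : s.sum ≤ card s)
    {h : ℕ} (hh : (s.sum : ℝ) ≤ 2 * σ * h) (hpos : 1 ≤ h) :
    (((card s - (h + 1))! * (h + 1)! * s.esymm (h + 1) : ℕ) : ℝ)
      ≤ (1 - σ / (4 * s.sum)) * (((card s - h)! * h ! * s.esymm h : ℕ) : ℝ) := by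
  have hε : (0 : ℝ) < s.sum := hσ.trans_le hle
  have hq : 0 ≤ 1 - σ / (4 * s.sum) := by
    rw [sub_nonneg, div_le_one (by positivity)]
    linarith
  rcases Nat.lt_or_ge h (card s) with hlt | hge
  · have h1 := succ_mul_esymm_succ_le hσ hs hmax hh hpos
    have h2 : (s.sum : ℝ) - h - σ / 4 ≤ (1 - σ / (4 * s.sum)) * ((card s : ℝ) - h) := by
      have h3 : (s.sum : ℝ) - h ≤ (card s : ℝ) - h := by
        have : (s.sum : ℝ) ≤ card s := by exact_mod_cast hcard
        linarith
      refine le_trans ?_ (mul_le_mul_of_nonneg_left h3 hq)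
      have h4 : (1 - σ / (4 * s.sum)) * ((s.sum : ℝ) - h)
          = (s.sum : ℝ) - h - σ / 4 + σ / (4 * s.sum) * h := by
        field_simp
        ring
      rw [h4]
      have : 0 ≤ σ / (4 * s.sum) * (h : ℝ) := by positivity
      linarith
    have h5 := h1.trans (mul_le_mul_of_nonneg_right h2 (Nat.cast_nonneg' (s.esymm h) (α := ℝ)))
    obtain ⟨j, hj⟩ : ∃ j, card s = h + 1 + j := ⟨card s - (h + 1), by omega⟩
    have e1 : card s - (h + 1) = j := by omega
    have e2 : card s - h = j + 1 := by omega
    rw [e1, e2, Nat.factorial_succ h, Nat.factorial_succ j]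
    have e3 : (card s : ℝ) - h = j + 1 := by
      rw [hj]
      push_cast
      ring
    rw [e3] at h5
    have h6 := mul_le_mul_of_nonneg_left h5 (by positivity : (0 : ℝ) ≤ (j ! : ℝ) * (h ! : ℝ))
    simp only [Nat.cast_mul, Nat.cast_add, Nat.cast_one]
    linarith
  -- Beyond the cardinality the subtraction truncates, but the polynomial vanishes.
  · rw [esymm_eq_zero_of_card_lt (by omega : card s < h + 1)]
    simp only [mul_zero, Nat.cast_zero]
    exact mul_nonneg hq (Nat.cast_nonneg' _)

/-! ### Products of factorials of multiplicities -/

open Nat in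
/-- The product of the factorials of the multiplicities in `m`: the number of labelled orderings
of `m` that give the same sequence. -/
def Multiset.countFactorial (m : Multiset ℕ) : ℕ := ∏ k ∈ m.toFinset, (m.count k)!

theorem Multiset.countFactorial_pos (m : Multiset ℕ) : 0 < m.countFactorial :=
  Finset.prod_pos fun _ _ => Nat.factorial_pos _

theorem Multiset.countFactorial_eq_count_mul {m : Multiset ℕ} {k : ℕ} (hk : k ∈ m) :
    m.countFactorial = m.count k * (m.erase k).countFactorial := by
  have h1 : (m.erase k).countFactorial = ∏ j ∈ m.toFinset, ((m.erase k).count j).factorial := by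
    refine Finset.prod_subset (fun j hj => ?_) fun j _ hj => ?_
    · simp only [mem_toFinset] at hj ⊢
      exact mem_of_mem_erase hj
    · rw [mem_toFinset] at hj
      rw [count_eq_zero_of_notMem hj, Nat.factorial_zero]
  have hk' : k ∈ m.toFinset := mem_toFinset.2 hk
  rw [h1, countFactorial, ← Finset.mul_prod_erase _ _ hk', ← Finset.mul_prod_erase _ _ hk',
    ← mul_assoc, count_erase_self, Nat.mul_factorial_pred (count_pos.2 hk).ne']
  congr 1
  refine Finset.prod_congr rfl fun j hj => ?_
  rw [count_erase_of_ne (Finset.ne_of_mem_erase hj)]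

/-- With the normalisation by `countFactorial`, a sum over the distinct elements of `m` becomes a
sum over all its elements, repeated according to multiplicity. -/
theorem Multiset.countFactorial_mul_sum (m : Multiset ℕ) (f : ℕ → ℕ) :
    m.countFactorial * ∑ k ∈ m.toFinset, f k
      = (m.map fun k => (m.erase k).countFactorial * f k).sum := by
  rw [Finset.sum_multiset_map_count, Finset.mul_sum]
  refine Finset.sum_congr rfl fun k hk => ?_
  rw [countFactorial_eq_count_mul (mem_toFinset.1 hk), smul_eq_mul, mul_assoc]

/-! ### Counting forests by removing the first root -/

namespace PlaneForest

/-- The multiset of out-degrees of the vertices of a forest. -/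
def degrees (F : PlaneForest) : Multiset ℕ := (((visit 0 F).map Prod.snd : List ℕ) : Multiset ℕ)

theorem degrees_append (F G : PlaneForest) : degrees (F ++ G) = degrees F + degrees G := by
  simp [degrees, visit_append]

theorem degrees_node_cons (cs ts : PlaneForest) :
    degrees (PlaneTree.node cs :: ts) = cs.length ::ₘ degrees (cs ++ ts) := by
  simp [degrees, visit_append, visit, visit_map_snd 1 0]

theorem card_degrees (F : PlaneForest) : Multiset.card (degrees F) = (visit 0 F).length := by
  simp [degrees]

theorem finite_degrees_eq (r : ℕ) (m : Multiset ℕ) :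
    {F : PlaneForest | F.length = r ∧ degrees F = m}.Finite := by
  refine (finite_length_le (Multiset.card m)).subset ?_
  rintro F ⟨_, hF⟩
  simp only [Set.mem_ofPred_eq, ← hF, card_degrees, le_refl]

/-- The forests with `r` trees whose multiset of out-degrees is `m`. -/
noncomputable def forests (r : ℕ) (m : Multiset ℕ) : Finset PlaneForest :=
  (finite_degrees_eq r m).toFinset

theorem mem_forests {r : ℕ} {m : Multiset ℕ} {F : PlaneForest} :
    F ∈ forests r m ↔ F.length = r ∧ degrees F = m := by
  simp [forests]

/-- Removing the root of the first tree, and keeping the list of its subtrees in its place, is a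
bijection once the out-degree `k` of this root is recorded. -/
theorem sum_forests_succ (r : ℕ) (m : Multiset ℕ) (g : PlaneForest → ℕ) :
    ∑ F ∈ forests (r + 1) m, g F
      = ∑ k ∈ m.toFinset, ∑ G ∈ forests (r + k) (m.erase k),
          g (PlaneTree.node (G.take k) :: G.drop k) := by
  rw [Finset.sum_sigma']
  symm
  refine Finset.sum_nbij (fun x => PlaneTree.node (x.2.take x.1) :: x.2.drop x.1) ?_ ?_ ?_ ?_
  · rintro ⟨k, G⟩ hx
    simp only [Finset.mem_sigma, Multiset.mem_toFinset, mem_forests] at hx ⊢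
    obtain ⟨hk, hl, hd⟩ := hx
    refine ⟨by simp [hl], ?_⟩
    rw [degrees_node_cons, List.take_append_drop, hd, List.length_take, hl,
      min_eq_left (Nat.le_add_left _ _), Multiset.cons_erase hk]
  · rintro ⟨k, G⟩ hx ⟨k', G'⟩ hx' he
    simp only [Finset.coe_sigma, Set.mem_sigma_iff, Finset.mem_coe, mem_forests] at hx hx'
    simp only [List.cons.injEq, PlaneTree.node.injEq] at he
    have hkk : k = k' := by
      have := congrArg List.length he.1
      rw [List.length_take, List.length_take, hx.2.1, hx'.2.1] at this
      omega
    subst hkk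
    have : G = G' := by
      rw [← List.take_append_drop k G, he.1, he.2, List.take_append_drop]
    rw [this]
  · intro F hF
    rw [Finset.mem_coe, mem_forests] at hF
    obtain ⟨hl, hd⟩ := hF
    rcases F with _ | ⟨⟨cs⟩, ts⟩
    · simp at hl
    · refine ⟨⟨cs.length, cs ++ ts⟩, ?_, by simp⟩
      rw [degrees_node_cons] at hd
      simp only [List.length_cons, Nat.add_right_cancel_iff] at hl
      simp only [Finset.coe_sigma, Set.mem_sigma_iff, Finset.mem_coe, mem_forests,
        Multiset.mem_toFinset, ← hd, Multiset.mem_cons_self, Multiset.erase_cons_head,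
        List.length_append, true_and, and_true]
      omega
  · intros
    rfl

theorem forests_zero (m : Multiset ℕ) (hm : m ≠ 0) : forests 0 m = ∅ := by
  ext F
  simp only [mem_forests, List.length_eq_zero_iff, Finset.notMem_empty, iff_false, not_and]
  rintro rfl
  simpa [degrees, visit] using hm.symm

open Nat in
/-- The number of forests with prescribed degrees: there are `r / n` times as many as there are
orderings of the `n` degrees. -/
theorem countFactorial_mul_card_forests (n : ℕ) (r : ℕ) (m : Multiset ℕ)
    (hn : Multiset.card m = n + 1) (hr : r + m.sum = n + 1) :
    m.countFactorial * (forests r m).card = r * n ! := by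
  induction n generalizing r m with
  | zero =>
    obtain ⟨k, rfl⟩ := Multiset.card_eq_one.1 (by simpa using hn)
    rw [Multiset.sum_singleton] at hr
    rcases r with _ | r
    · rw [forests_zero _ (by simp)]
      simp
    · obtain ⟨rfl, rfl⟩ : r = 0 ∧ k = 0 := by omega
      have h0 : forests 0 0 = {[]} := by
        ext F
        simp only [mem_forests, List.length_eq_zero_iff, Finset.mem_singleton,
          and_iff_left_iff_imp]
        rintro rfl
        simp [degrees, visit]
      have h1 := sum_forests_succ 0 {0} (fun _ => 1)
      simp only [Finset.sum_const, Multiset.toFinset_singleton, Finset.sum_singleton, zero_add,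
        Multiset.erase_singleton, h0, Finset.card_singleton, smul_eq_mul, mul_one] at h1
      rw [zero_add, h1]
      simp [Multiset.countFactorial]
  | succ n ih =>
    rcases r with _ | r
    · rw [forests_zero _ (by rintro rfl; simp at hn)]
      simp
    have h1 := sum_forests_succ r m (fun _ => 1)
    simp only [Finset.sum_const, smul_eq_mul, mul_one] at h1
    rw [h1, Multiset.countFactorial_mul_sum]
    have h2 : (m.map fun k => (m.erase k).countFactorial * (forests (r + k) (m.erase k)).card)
        = m.map fun k => (r + k) * n ! := by
      refine Multiset.map_congr rfl fun k hk => ih _ _ ?_ ?_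
      · rw [Multiset.card_erase_of_mem hk, hn]
        rfl
      · have := Multiset.sum_erase hk
        omega
    rw [h2, Multiset.sum_map_mul_right, Multiset.sum_map_add, Multiset.map_const', Multiset.map_id',
      Multiset.sum_replicate, hn, smul_eq_mul, Nat.factorial_succ, ← mul_assoc]
    congr 1
    have : m.sum + r = n + 1 := by omega
    nlinarith

/-! ### Vertices above a given height -/

/-- The number of vertices of a forest at height at least `h`. -/
def countAbove (h : ℕ) (F : PlaneForest) : ℕ := (visit 0 F).countP fun p => h ≤ p.1

theorem countAbove_append (h : ℕ) (F G : PlaneForest) :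
    countAbove h (F ++ G) = countAbove h F + countAbove h G := by
  simp [countAbove, visit_append]

theorem visit_succ (h : ℕ) (F : PlaneForest) :
    visit (h + 1) F = (visit h F).map fun p => (p.1 + 1, p.2) := by
  induction h, F using visit.induct with
  | case1 h => simp [visit]
  | case2 h cs ts ih1 ih2 => simp [visit, ih1, ih2]

theorem countAbove_succ_singleton (h : ℕ) (cs : PlaneForest) :
    countAbove (h + 1) [PlaneTree.node cs] = countAbove h cs := by
  simp [countAbove, visit, visit_succ, List.countP_map, Function.comp_def]

theorem countAbove_zero (F : PlaneForest) : countAbove 0 F = Multiset.card (degrees F) := by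
  simp [countAbove, card_degrees]

/-- The number of pairs of a forest with `r` trees and degrees `m`, and of a vertex of its first
tree at height at least `h`. -/
noncomputable def countFirst (h r : ℕ) (m : Multiset ℕ) : ℕ :=
  ∑ F ∈ forests r m, countAbove h (F.take 1)

/-- The trees of a random forest are exchangeable: the vertices of the `i`-th tree contribute as
much as those of the first. -/
theorem sum_countAbove_getElem (h r : ℕ) (m : Multiset ℕ) {i : ℕ} (hi : i < r) :
    ∑ F ∈ forests r m, countAbove h (F[i]?.toList) = countFirst h r m := by
  have hmem : ∀ j ≤ r, ∀ F ∈ forests r m, F.rotate j ∈ forests r m := by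
    intro j hj F hF
    rw [mem_forests] at hF ⊢
    refine ⟨by rw [List.length_rotate, hF.1], ?_⟩
    rw [List.rotate_eq_drop_append_take (hj.trans_eq hF.1.symm), degrees_append, add_comm,
      ← degrees_append, List.take_append_drop, hF.2]
  refine Finset.sum_bij' (fun F _ => F.rotate i) (fun F _ => F.rotate (r - i))
    (hmem _ hi.le) (hmem _ (Nat.sub_le _ _)) ?_ ?_ ?_
  · intro F hF
    rw [List.rotate_rotate, Nat.add_sub_cancel' hi.le, ← (mem_forests.1 hF).1, List.rotate_length]
  · intro F hF
    rw [List.rotate_rotate, Nat.sub_add_cancel hi.le, ← (mem_forests.1 hF).1, List.rotate_length]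
  · intro F hF
    rw [List.take_one, List.head?_rotate (hi.trans_eq (mem_forests.1 hF).1.symm)]

theorem sum_countAbove_take (h r : ℕ) (m : Multiset ℕ) {k : ℕ} (hk : k ≤ r) :
    ∑ F ∈ forests r m, countAbove h (F.take k) = k * countFirst h r m := by
  induction k with
  | zero => simp [countAbove, visit]
  | succ k ih =>
    simp only [List.take_add_one, countAbove_append]
    rw [Finset.sum_add_distrib, ih (by omega), sum_countAbove_getElem h r m hk]
    ring

theorem sum_countAbove (h r : ℕ) (m : Multiset ℕ) :
    ∑ F ∈ forests r m, countAbove h F = r * countFirst h r m := by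
  rw [← sum_countAbove_take h r m le_rfl]
  refine Finset.sum_congr rfl fun F hF => ?_
  rw [← (mem_forests.1 hF).1, List.take_length]

theorem sum_countAbove_zero (r : ℕ) (m : Multiset ℕ) :
    ∑ F ∈ forests r m, countAbove 0 F = (forests r m).card * Multiset.card m := by
  rw [← smul_eq_mul, ← Finset.sum_const]
  refine Finset.sum_congr rfl fun F hF => ?_
  rw [countAbove_zero, (mem_forests.1 hF).2]

/-- The pairs of a forest and a vertex of its first tree at height at least `h` correspond to the
choices of the out-degrees of the first `h` ancestors and of the branches taken by the path, and
of an ordering of the other out-degrees. In particular their number depends on the number of trees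
only through `m`. -/
theorem countFactorial_mul_countFirst (h r : ℕ) (m : Multiset ℕ) (hr : 1 ≤ r)
    (hm : r + m.sum = Multiset.card m) :
    m.countFactorial * countFirst h r m
      = (Multiset.card m - h).factorial * h.factorial * m.esymm h := by
  induction h generalizing r m with
  | zero =>
    obtain ⟨n, hn⟩ : ∃ n, Multiset.card m = n + 1 := ⟨Multiset.card m - 1, by omega⟩
    have h1 := sum_countAbove 0 r m
    rw [sum_countAbove_zero] at h1
    have h2 := countFactorial_mul_card_forests n r m hn (hm.trans hn)
    rw [hn] at h1
    refine Nat.eq_of_mul_eq_mul_left (Nat.pos_of_ne_zero (by omega) : 0 < r) ?_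
    rw [mul_left_comm, ← h1, ← mul_assoc, h2, Multiset.esymm_zero', hn, Nat.sub_zero,
      Nat.factorial_succ]
    simp only [Nat.factorial_zero]
    ring
  | succ h ih =>
    obtain ⟨r, rfl⟩ : ∃ j, r = j + 1 := ⟨r - 1, by omega⟩
    rw [countFirst, sum_forests_succ, Multiset.countFactorial_mul_sum]
    have h1 : (m.map fun k => (m.erase k).countFactorial *
          ∑ G ∈ forests (r + k) (m.erase k),
            countAbove (h + 1) ((PlaneTree.node (G.take k) :: G.drop k).take 1))
        = m.map fun k => (Multiset.card m - (h + 1)).factorial * h.factorial *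
            (k * (m.erase k).esymm h) := by
      refine Multiset.map_congr rfl fun k hk => ?_
      simp only [List.take_succ_cons, List.take_zero, countAbove_succ_singleton]
      rw [sum_countAbove_take h _ _ (Nat.le_add_left k r)]
      -- For `k = 0` the remaining forest may be empty, but the term carries the factor `k`.
      rcases Nat.eq_zero_or_pos k with rfl | hk0
      · simp
      · have h2 := Multiset.sum_erase hk
        have h3 := Multiset.card_erase_add_one hk
        have h4 := ih (r + k) (m.erase k) (by omega) (by omega)
        have h5 : Multiset.card (m.erase k) - h = Multiset.card m - (h + 1) := by omega
        rw [mul_left_comm, h4, h5]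
        ring
    rw [h1, Multiset.sum_map_mul_left, Multiset.sum_mul_esymm_erase, Nat.factorial_succ,
      Nat.cast_id]
    ring

end PlaneForest

/-! ### The height of a uniformly random vertex -/

theorem List.card_filter_get {α : Type*} (l : List α) (p : α → Prop) [DecidablePred p] :
    (Finset.univ.filter fun i : Fin l.length => p (l.get i)).card = l.countP fun a => p a := by
  rw [Finset.card_filter]
  have h1 := Fin.sum_univ_fun_getElem l fun a => if p a then 1 else 0
  simp only [List.get_eq_getElem]
  rw [h1]
  clear h1
  induction l with
  | nil => simp
  | cons a l ih =>
    rw [List.map_cons, List.sum_cons, ih, List.countP_cons, add_comm]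
    simp

namespace DegreeSequence

open PlaneForest

/-- The multiset of the out-degrees prescribed by a degree sequence. -/
noncomputable def degreeMultiset (D : DegreeSequence) : Multiset ℕ := Finsupp.toMultiset D.count

theorem sum_map_degreeMultiset {R : Type*} [Semiring R] (D : DegreeSequence) (f : ℕ → R) :
    (D.degreeMultiset.map f).sum = ∑ k ∈ D.count.support, f k * (D.count k : R) := by
  rw [Finset.sum_multiset_map_count, degreeMultiset, Finsupp.toFinset_toMultiset]
  refine Finset.sum_congr rfl fun k _ => ?_
  rw [Finsupp.count_toMultiset, nsmul_eq_mul, Nat.cast_comm]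

theorem sum_degreeMultiset (D : DegreeSequence) : D.degreeMultiset.sum = D.numEdges := by
  have := D.sum_map_degreeMultiset (fun k => k)
  simpa [numEdges] using this

theorem trees_add_sum_degreeMultiset (D : DegreeSequence) :
    D.trees + D.degreeMultiset.sum = Multiset.card D.degreeMultiset := by
  have h1 : Multiset.card D.degreeMultiset = ∑ k ∈ D.count.support, D.count k := by
    have := D.sum_map_degreeMultiset (fun _ => (1 : ℕ))
    simpa using this
  have h2 := D.trees_eq
  simp only [sub_mul, one_mul, Finset.sum_sub_distrib] at h2
  rw [sum_degreeMultiset, h1, numEdges]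
  zify
  linarith

theorem mem_forests_iff (D : DegreeSequence) (F : PlaneForest) :
    F ∈ forests D.trees D.degreeMultiset ↔ F.length = D.trees ∧
      ∀ k : ℕ, (Finset.univ.filter fun x : Vertex F => numChildren x = k).card = D.count k := by
  simp only [mem_forests, card_numChildren, Multiset.ext, degrees, Multiset.coe_count,
    degreeMultiset, Finsupp.count_toMultiset]

theorem sum_forest_eq {M : Type*} [AddCommMonoid M] (D : DegreeSequence) (f : PlaneForest → M) :
    ∑ F : D.Forest, f F.1 = ∑ F ∈ forests D.trees D.degreeMultiset, f F :=
  Finset.sum_bij (fun F _ => F.1) (fun F _ => (D.mem_forests_iff F.1).2 F.2)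
    (fun _ _ _ _ h => Subtype.ext h)
    (fun F hF => ⟨⟨F, (D.mem_forests_iff F).1 hF⟩, Finset.mem_univ _, rfl⟩) (fun _ _ => rfl)

theorem toOuterMeasure_uniformOfFintype_height_ge (h : ℕ) (F : PlaneForest)
    [Nonempty (Vertex F)] :
    (PMF.uniformOfFintype (Vertex F)).toOuterMeasure {x | h ≤ height x}
      = (countAbove h F : ENNReal) / (Multiset.card (degrees F) : ENNReal) := by
  have hc : Fintype.card {x : Vertex F | h ≤ height x} = countAbove h F := by
    rw [countAbove, ← List.card_filter_get, ← Fintype.card_subtype]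
    rfl
  rw [PMF.toOuterMeasure_uniformOfFintype_apply, hc, Fintype.card_fin, card_degrees]

/-- The probability that `|x| ≥ h` is the quotient of the numbers of forests with a marked vertex
in the first tree, at height at least `h` or without constraint. -/
theorem uniformVertex_height_ge (D : DegreeSequence) (h : ℕ) :
    D.uniformVertex.toOuterMeasure {p | h ≤ height p.2}
      = ((D.trees * countFirst h D.trees D.degreeMultiset : ℕ) : ENNReal)
        / ((D.trees * countFirst 0 D.trees D.degreeMultiset : ℕ) : ENNReal) := by
  have hF : ∀ F : D.Forest, ((PMF.uniformOfFintype (Vertex F.1)).map (Sigma.mk F)).toOuterMeasure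
      {p : (F : D.Forest) × Vertex F.1 | h ≤ height p.2}
      = (countAbove h F.1 : ENNReal) / (Multiset.card D.degreeMultiset : ENNReal) := by
    intro F
    rw [PMF.toOuterMeasure_map_apply, ← (mem_forests.1 ((D.mem_forests_iff F.1).2 F.2)).2]
    exact toOuterMeasure_uniformOfFintype_height_ge h F.1
  have hcard : (Fintype.card D.Forest) = (forests D.trees D.degreeMultiset).card := by
    have := D.sum_forest_eq (fun _ => 1)
    simpa using this
  rw [uniformVertex, PMF.toOuterMeasure_bind_apply, tsum_fintype]
  simp only [hF, uniformForest, PMF.uniformOfFintype_apply, hcard]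
  rw [← sum_countAbove, ← sum_countAbove, sum_countAbove_zero, ← Finset.mul_sum]
  simp only [div_eq_mul_inv]
  rw [← Finset.sum_mul, D.sum_forest_eq (fun F => (countAbove h F : ENNReal)), Nat.cast_sum,
    Nat.cast_mul, ENNReal.mul_inv (Or.inr (ENNReal.natCast_ne_top _))
      (Or.inl (ENNReal.natCast_ne_top _))]
  ring

theorem uniformVertex_height_ge_le (D : DegreeSequence) (h : ℕ) {q : ℝ} (hq : 0 ≤ q)
    (hle : (countFirst h D.trees D.degreeMultiset : ℝ)
      ≤ q * countFirst 0 D.trees D.degreeMultiset) :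
    D.uniformVertex.toOuterMeasure {p | h ≤ height p.2} ≤ ENNReal.ofReal q := by
  rw [uniformVertex_height_ge]
  refine ENNReal.div_le_of_le_mul ?_
  rw [← ENNReal.ofReal_natCast, ← ENNReal.ofReal_natCast, ← ENNReal.ofReal_mul hq]
  refine ENNReal.ofReal_le_ofReal ?_
  rw [Nat.cast_mul, Nat.cast_mul]
  have := mul_le_mul_of_nonneg_left hle (Nat.cast_nonneg' D.trees (α := ℝ))
  linarith

theorem countFirst_le_zero (h r : ℕ) (m : Multiset ℕ) : countFirst h r m ≤ countFirst 0 r m :=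
  Finset.sum_le_sum fun _ _ => List.countP_mono_left fun _ _ _ => by simp

theorem sigma_sq (D : DegreeSequence) :
    (D.degreeMultiset.map fun k : ℕ => (k : ℝ) * ((k : ℝ) - 1)).sum = D.sigma ^ 2 := by
  rw [sum_map_degreeMultiset, sigma, Real.sq_sqrt]
  exact Finset.sum_nonneg fun k _ =>
    mul_nonneg (Multiset.natCast_mul_sub_one_nonneg k) (Nat.cast_nonneg' _)

theorem mul_sub_one_le_sigma_sq (D : DegreeSequence) {k : ℕ} (hk : k ∈ D.degreeMultiset) :
    (k : ℝ) * ((k : ℝ) - 1) ≤ D.sigma ^ 2 := by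
  rw [← sigma_sq]
  refine Multiset.single_le_sum (fun x hx => ?_) _ (Multiset.mem_map_of_mem _ hk)
  obtain ⟨j, _, rfl⟩ := Multiset.mem_map.1 hx
  exact Multiset.natCast_mul_sub_one_nonneg j

theorem one_le_sigma (D : DegreeSequence) (hD : 2 ≤ D.maxDegree) : 1 ≤ D.sigma := by
  obtain ⟨k, hk, hk2⟩ : ∃ k ∈ D.count.support, 2 ≤ k := by
    simpa using (Finset.le_sup_iff (by norm_num : (⊥ : ℕ) < 2)).1 hD
  have h1 := D.mul_sub_one_le_sigma_sq (k := k) (by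
    rw [degreeMultiset, Finsupp.mem_toMultiset]
    exact hk)
  have h2 : (2 : ℝ) ≤ k := by exact_mod_cast hk2
  have h3 : 0 ≤ D.sigma := Real.sqrt_nonneg _
  nlinarith

theorem le_two_mul_sigma (D : DegreeSequence) (hσ : 1 ≤ D.sigma) {k : ℕ}
    (hk : k ∈ D.degreeMultiset) : (k : ℝ) ≤ 2 * D.sigma := by
  have h1 := D.mul_sub_one_le_sigma_sq hk
  nlinarith

theorem sigma_le_numEdges (D : DegreeSequence) : D.sigma ≤ D.numEdges := by
  have h0 : D.sigma ^ 2 ≤ (D.numEdges : ℝ) ^ 2 := by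
    rw [← sigma_sq]
    calc (D.degreeMultiset.map fun k : ℕ => (k : ℝ) * ((k : ℝ) - 1)).sum
        ≤ (D.degreeMultiset.map fun k : ℕ => (k : ℝ) * (D.numEdges : ℝ)).sum := by
          refine Multiset.sum_map_le_sum_map _ _ fun k hk => ?_
          have : (k : ℝ) ≤ D.numEdges := by
            rw [← sum_degreeMultiset]
            exact_mod_cast Multiset.single_le_sum (fun _ _ => Nat.zero_le _) _ hk
          exact mul_le_mul_of_nonneg_left (by linarith) (Nat.cast_nonneg' k)
      _ = (D.numEdges : ℝ) ^ 2 := by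
          rw [Multiset.sum_map_mul_right, ← sum_degreeMultiset, Nat.cast_multiset_sum, sq]
  exact le_of_sq_le_sq h0 (Nat.cast_nonneg' _)

/-- The count of the vertices at height at least `h` decays geometrically from
`h = ⌊ε / σ⌋` on, at rate `σ / (4 * ε)`. -/
theorem countFirst_floor_add_le (D : DegreeSequence) (hD : 2 ≤ D.maxDegree) (j : ℕ) :
    (countFirst (⌊(D.numEdges : ℝ) / D.sigma⌋₊ + j) D.trees D.degreeMultiset : ℝ)
      ≤ (1 - D.sigma / (4 * D.numEdges)) ^ j * countFirst 0 D.trees D.degreeMultiset := by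
  have hσ1 := D.one_le_sigma hD
  have hσ : 0 < D.sigma := by linarith
  have hle := D.sigma_le_numEdges
  have hε : (0 : ℝ) < D.numEdges := hσ.trans_le hle
  have hq : 0 ≤ 1 - D.sigma / (4 * D.numEdges) := by
    rw [sub_nonneg, div_le_one (by positivity)]
    linarith
  induction j with
  | zero => simpa using countFirst_le_zero _ _ _
  | succ j ih =>
    set h := ⌊(D.numEdges : ℝ) / D.sigma⌋₊ + j with hh
    have hone : 1 ≤ ⌊(D.numEdges : ℝ) / D.sigma⌋₊ :=
      Nat.le_floor (by rwa [Nat.cast_one, one_le_div hσ])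
    have hbig : (D.numEdges : ℝ) ≤ 2 * D.sigma * h := by
      have h1 := Nat.lt_floor_add_one ((D.numEdges : ℝ) / D.sigma)
      rw [div_lt_iff₀ hσ] at h1
      have h2 : (1 : ℝ) ≤ ⌊(D.numEdges : ℝ) / D.sigma⌋₊ := by exact_mod_cast hone
      have h3 : ((⌊(D.numEdges : ℝ) / D.sigma⌋₊ : ℝ)) ≤ h := by
        exact_mod_cast Nat.le_add_right _ _
      nlinarith
    have key := Multiset.factorial_mul_esymm_succ_le (s := D.degreeMultiset) hσ D.sigma_sq
      (fun k hk => D.le_two_mul_sigma hσ1 hk) (by rwa [sum_degreeMultiset])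
      (by have := D.trees_add_sum_degreeMultiset; omega) (h := h)
      (by rwa [sum_degreeMultiset]) (by omega)
    rw [← countFactorial_mul_countFirst _ _ _ D.trees_pos D.trees_add_sum_degreeMultiset,
      ← countFactorial_mul_countFirst _ _ _ D.trees_pos D.trees_add_sum_degreeMultiset,
      sum_degreeMultiset, Nat.cast_mul, Nat.cast_mul, mul_left_comm] at key
    have hpos : (0 : ℝ) < D.degreeMultiset.countFactorial := by
      exact_mod_cast Multiset.countFactorial_pos _
    have key2 := le_of_mul_le_mul_left key hpos
    rw [← add_assoc, ← hh, pow_succ', mul_assoc]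
    exact key2.trans (mul_le_mul_of_nonneg_left ih hq)

end DegreeSequence

theorem mainTheorem4 :
    ∃ c₁ c₂ : ℝ, 0 < c₁ ∧ 0 < c₂ ∧
      ∀ D : DegreeSequence, 2 ≤ D.maxDegree → ∀ z : ℝ, 1 ≤ z →
        D.uniformVertex.toOuterMeasure
            {p | z * (D.numEdges : ℝ) / D.sigma ≤ (PlaneForest.height p.2 : ℝ)}
          ≤ ENNReal.ofReal (c₁ * Real.exp (-c₂ * z)) := by
  -- The rate is that of `countFirst_floor_add_le`; the factor `exp (1 / 4)` pays for the levels
  -- below `⌊ε / σ⌋`, where only the trivial bound by `1` is available.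
  refine ⟨Real.exp (1 / 4), 1 / 4, Real.exp_pos _, by norm_num, fun D hD z hz => ?_⟩
  have hσ : 0 < D.sigma := by linarith [D.one_le_sigma hD]
  have hle := D.sigma_le_numEdges
  have hε : (0 : ℝ) < D.numEdges := hσ.trans_le hle
  set a : ℝ := (D.numEdges : ℝ) / D.sigma with ha
  have ha0 : 0 < a := div_pos hε hσ
  have hset : {p : (F : D.Forest) × PlaneForest.Vertex F.1 |
      z * (D.numEdges : ℝ) / D.sigma ≤ (PlaneForest.height p.2 : ℝ)}
      = {p | ⌈z * a⌉₊ ≤ PlaneForest.height p.2} := by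
    ext p
    simp only [Set.mem_ofPred_eq, Nat.ceil_le, mul_div_assoc, ha]
  rw [hset]
  obtain ⟨j, hj⟩ : ∃ j, ⌈z * a⌉₊ = ⌊a⌋₊ + j := by
    refine ⟨⌈z * a⌉₊ - ⌊a⌋₊, (Nat.add_sub_cancel' ?_).symm⟩
    exact (Nat.floor_le_ceil a).trans (Nat.ceil_le_ceil (by nlinarith))
  have hq : 1 - D.sigma / (4 * D.numEdges) = 1 - 1 / (4 * a) := by
    rw [ha]
    field_simp
  have hq0 : 0 ≤ 1 - 1 / (4 * a) := by
    have : 1 ≤ a := by rwa [ha, one_le_div hσ]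
    rw [sub_nonneg, div_le_one (by positivity)]
    linarith
  have hcount := D.countFirst_floor_add_le hD j
  rw [hq, ← ha, ← hj] at hcount
  refine (D.uniformVertex_height_ge_le _ (pow_nonneg hq0 j) hcount).trans
    (ENNReal.ofReal_le_ofReal ?_)
  have hjle : z * a - a ≤ j := by
    have h1 := Nat.le_ceil (z * a)
    have h2 := Nat.floor_le ha0.le
    rw [hj, Nat.cast_add] at h1
    linarith
  calc (1 - 1 / (4 * a)) ^ j ≤ Real.exp (-(1 / (4 * a))) ^ j :=
        pow_le_pow_left₀ hq0 (Real.one_sub_le_exp_neg _) j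
    _ = Real.exp (j * -(1 / (4 * a))) := (Real.exp_nat_mul _ _).symm
    _ ≤ Real.exp (1 / 4 + -(1 / 4) * z) := by
        refine Real.exp_le_exp.2 ?_
        have h1 := mul_le_mul_of_nonneg_right hjle (by positivity : 0 ≤ 1 / (4 * a))
        have h2 : (z * a - a) * (1 / (4 * a)) = 1 / 4 * z - 1 / 4 := by
          field_simp
        linarith
    _ = Real.exp (1 / 4) * Real.exp (-(1 / 4) * z) := Real.exp_add _ _
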